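/- Let $\mathbb{D}=\{u\in\mathbb{C}:|u|<1\}$. For $n\ge 1$ and $\sigma=(\lambda_1,\dots,\lambda_n)\in\mathbb{D}^n$ (repetitions allowed) let $$B(u)=B_\sigma(u)=\prod_{j=1}^n\frac{\lambda_j-u}{1-\overline{\lambda_j}u},\qquad k_z^B(u)=\frac{1-\overline{B(z)}B(u)}{1-\overline{z}u}\qquad(z\in\overline{\mathbb{D}},\ u\in\mathbb{D}).$$ For $f$ holomorphic in $\mathbb{D}$ put $\|f\|_{H^\infty}=\sup_{u\in\mathbb{D}}|f(u)|$ and $$\|f\|_{H^q}=\sup_{0\le\rho<1}\Big(\frac1{2\pi}\int_0^{2\pi}|f(\rho e^{i\theta})|^q\,d\theta\Big)^{1/q}\ (1<q<\infty),\qquad \|f\|_{\mathcal{B}_\alpha}=\sup_{u\in\mathbb{D}}|f'(u)|(1-|u|)^\alpha\ (0\le\alpha\le1),$$ $$\|f\|_{A^q(\gamma)}=\Big(\int_{\mathbb{D}}|f(u)|^q(1-|u|^2)^\gamma\,d\mathcal{A}(u)\Big)^{1/q}\ (1<q<\infty,\ \gamma>-1),$$ where $\mathcal{A}$ is the area measure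 on $\mathbb{D}$ normalized by $\mathcal{A}(\mathbb{D})=1$. Derivatives of $k_z^B$ are taken with respect to $u$. **Proposition 4.1.** The following inequalities hold for all $n\ge1$, all $r\in[0,1)$, all $\sigma=(\lambda_1,\dots,\lambda_n)\in\mathbb{D}^n$ with $\max_j|\lambda_j|\le r$, $B=B_\sigma$, and all $z\in\overline{\mathbb{D}}$. 1. For every $q\in(1,+\infty]$ there is a constant $C=C(q)>0$ with $\displaystyle\|k_z^B\|_{H^q}\le C\Big(\frac{n}{1-r}\Big)^{1-\frac1q}$ (with $1/\infty=0$). 2. For every integer $l\ge0$ and every $\alpha\in[0,1]$ there is a constant $C=C(l,\alpha)>0$ with $\displaystyle\|(k_z^B)^{(l)}\|_{\mathcal{B}_\alpha}\le C\Big(\frac{n}{1-r}\Big)^{l+2-\alpha}$. 3. For every $q\in(1,+\infty)$ and $\gamma\in(-1,q-1]$ there is a constant $C=C(q,\gamma)>0$ with $\displaystyle\|(k_z^B)'\|_{A^q(\gamma)}\le C\Big(\frac{n}{1-r}\Big)^{2-\frac{\gamma+2}{q}}$. 4. For every $q\in(1,+\infty)$ and $\gamma\in(-1,q]$ there is a constant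 $C=C(q,\gamma)>0$ with $\displaystyle\|(k_z^B)''\|_{A^q(\gamma)}\le C\Big(\frac{n}{1-r}\Big)^{3-\frac{\gamma+2}{q}}$. The constants do not depend on $n$, $r$, $\sigma$ and $z$. -/

import Mathlib

open scoped ENNReal ComplexConjugate

noncomputable section

/-- The finite Blaschke product `B_σ(u) = ∏ⱼ (λⱼ - u) / (1 - conj λⱼ * u)`
of a finite sequence `σ = (λ₁, …, λₙ)`. -/
def blaschkeProduct {n : ℕ} (σ : Fin n → ℂ) (u : ℂ) : ℂ :=
  ∏ j, (σ j - u) / (1 - conj (σ j) * u)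

/-- The reproducing kernel
`k_z^B(u) = (1 - conj (B z) * B u) / (1 - conj z * u)` of the model space of `B = B_σ`.
It is used for `z` in the closed disc and as a function of `u` in the open disc,
where the denominator does not vanish. -/
def modelKernel {n : ℕ} (σ : Fin n → ℂ) (z u : ℂ) : ℂ :=
  (1 - conj (blaschkeProduct σ z) * blaschkeProduct σ u) / (1 - conj z * u)

/-- The Hardy norm of a function holomorphic in the unit disc, with values in `[0, ∞]`:
the supremum over the disc if `q = ∞`, and the supremum over `0 ≤ ρ < 1` of
`((2π)⁻¹ ∫_0^{2π} |f(ρ e^{iθ})|^q dθ)^{1/q}` if `q < ∞`. -/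
def hardyNorm (q : ℝ≥0∞) (f : ℂ → ℂ) : ℝ≥0∞ :=
  if q = ∞ then ⨆ u ∈ Metric.ball (0 : ℂ) 1, ‖f u‖ₑ
  else ⨆ ρ ∈ Set.Ico (0 : ℝ) 1,
    ((ENNReal.ofReal (2 * Real.pi))⁻¹ *
      ∫⁻ θ in Set.Ioc (0 : ℝ) (2 * Real.pi),
        ‖f (circleMap 0 ρ θ)‖ₑ ^ q.toReal) ^ (1 / q.toReal)

/-- The norm of the radial-weighted Bergman space `A^q(γ)`, with values in `[0, ∞]`:
`(∫_𝔻 |f(u)|^q (1 - |u|²)^γ d𝒜(u))^{1/q}`, where `𝒜` is the area measure divided by `π`. -/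
def bergmanNorm (q γ : ℝ) (f : ℂ → ℂ) : ℝ≥0∞ :=
  ((ENNReal.ofReal Real.pi)⁻¹ *
    ∫⁻ u in Metric.ball (0 : ℂ) 1,
      ‖f u‖ₑ ^ q * ENNReal.ofReal ((1 - ‖u‖ ^ 2) ^ γ)) ^ (1 / q)

/-- The seminorm of the weighted Bloch space `ℬ_α`, with values in `[0, ∞]`:
`sup_{u ∈ 𝔻} |f'(u)| (1 - |u|)^α`. -/
def blochNorm (α : ℝ) (f : ℂ → ℂ) : ℝ≥0∞ :=
  ⨆ u ∈ Metric.ball (0 : ℂ) 1, ‖deriv f u‖ₑ * ENNReal.ofReal ((1 - ‖u‖) ^ α)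

end

/-! Put ε = (1 - r)/n. The kernel extends holomorphically to |v| ≤ 1 + ε/2, and it stays bounded
there independently of the zeros: each Blaschke factor is at most 1 + 12/n, so any product of at
most n of them is at most e^12.

Telescoping 1 - conj(B(z)) B(v) removes the denominator 1 - conj(z) v. Bounding the quotient gives
|k| |1 - conj(z) v| ≤ 2e^12, and bounding the n telescoped terms gives ε |k| ≤ 4e^12. Together
(`norm_telescopedKernel_mul_le`), |k(v)| ≲ 1/(ε + |1 - conj(z) v|). Cauchy's estimate on a disc of
radius (ε + 1 - |u|)/2 turns this into `norm_iteratedDeriv_modelKernel_le`, with one factor 1/(ε + 1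
- |u|) per derivative.

The norms then follow from this pointwise bound alone. Suprema use that both factors are at least ε.
Circular means of order q > 1 gain one power (`lintegral_circle_rpow_le`). Area integrals reduce in
polar coordinates to ∫ (ε + s)^(-p) s^γ ds, which scales like ε^(γ+1-p) when -1 < γ < p - 1. -/

open MeasureTheory

/-! ### Bounds for the kernel slightly beyond the unit circle. -/

/-- The telescoped form of the kernel `modelKernel σ z`, holomorphic on a neighbourhood of the
closed disc. -/
noncomputable def telescopedKernel {n : ℕ} (σ : Fin n → ℂ) (z u : ℂ) : ℂ :=
  ∑ j, (1 - conj (σ j) * σ j) / ((1 - σ j * conj z) * (1 - conj (σ j) * u)) *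
    ∏ i ∈ Finset.univ with i < j,
      (conj ((σ i - z) / (1 - conj (σ i) * z)) * ((σ i - u) / (1 - conj (σ i) * u)))

lemma half_le_norm_one_sub {a v : ℂ} {ε : ℝ} (ha : ε ≤ 1 - ‖a‖) (hε : 0 < ε)
    (hv : ‖v‖ ≤ 1 + ε / 2) : (1 - ‖a‖) / 2 ≤ ‖1 - conj a * v‖ := by
  have h1 : ‖(1 : ℂ)‖ - ‖conj a * v‖ ≤ ‖1 - conj a * v‖ := norm_sub_norm_le _ _
  rw [norm_one, norm_mul, RCLike.norm_conj] at h1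
  nlinarith [norm_nonneg a, norm_nonneg v]

lemma one_sub_mul_conj_ne_zero {a z : ℂ} (ha : ‖a‖ < 1) (hz : ‖z‖ ≤ 1) : 1 - a * conj z ≠ 0 := by
  intro h
  have h1 : a * conj z = 1 := (sub_eq_zero.mp h).symm
  have h2 : ‖a‖ * ‖z‖ = 1 := by rw [← RCLike.norm_conj z, ← norm_mul, h1, norm_one]
  nlinarith [norm_nonneg a, norm_nonneg z]

lemma one_sub_conj_mul_ne_zero {a v : ℂ} {ε : ℝ} (ha : ε ≤ 1 - ‖a‖) (hε : 0 < ε)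
    (hv : ‖v‖ ≤ 1 + ε / 2) : 1 - conj a * v ≠ 0 := by
  have := half_le_norm_one_sub ha hε hv
  rw [← norm_pos_iff]
  linarith

lemma telescopedKernel_mul {n : ℕ} {σ : Fin n → ℂ} {z v : ℂ}
    (hz : ∀ j, 1 - σ j * conj z ≠ 0) (hv : ∀ j, 1 - conj (σ j) * v ≠ 0) :
    telescopedKernel σ z v * (1 - conj z * v) =
      1 - conj (blaschkeProduct σ z) * blaschkeProduct σ v := by
  -- Each factor b is written as 1 - (1 - b). For one zero, 1 - b has 1 - conj z * v as a factor, so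
  -- this factor comes out of every summand.
  have h := Finset.prod_one_sub_ordered (s := (Finset.univ : Finset (Fin n)))
    (fun i => 1 - conj ((σ i - z) / (1 - conj (σ i) * z)) * ((σ i - v) / (1 - conj (σ i) * v)))
  simp only [sub_sub_cancel] at h
  rw [blaschkeProduct, blaschkeProduct, map_prod, ← Finset.prod_mul_distrib, h, sub_sub_cancel,
    telescopedKernel, Finset.sum_mul]
  refine Finset.sum_congr rfl fun j _ => ?_
  rw [mul_right_comm]
  congr 1
  have h1 := hz j
  have h2 := hv j
  simp only [map_div₀, map_sub, map_mul, map_one, Complex.conj_conj]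
  field_simp
  ring

/-- By the identity |a - v|² = |1 - conj(a) v|² + (|v|² - 1)(1 - |a|²), the excess over modulus 1
comes from the last term, at most 3ε(1 - |a|). As mε ≤ 1 - |a| ≤ 2|1 - conj(a) v|, it is at most
(12/m)|1 - conj(a) v|². Used with m = n. -/
lemma norm_blaschkeFactor_le {a v : ℂ} {ε m : ℝ} (hm : 1 ≤ m) (ha : m * ε ≤ 1 - ‖a‖)
    (hε : 0 < ε) (hv : ‖v‖ ≤ 1 + ε / 2) :
    ‖(a - v) / (1 - conj a * v)‖ ≤ 1 + 12 / m := by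
  have hεa : ε ≤ 1 - ‖a‖ := by nlinarith
  have hd := half_le_norm_one_sub hεa hε hv
  have ha0 := norm_nonneg a
  have hv0 := norm_nonneg v
  have hdp : 0 < ‖1 - conj a * v‖ := by linarith
  have hid : ‖a - v‖ ^ 2 = ‖1 - conj a * v‖ ^ 2 + (‖v‖ ^ 2 - 1) * (1 - ‖a‖ ^ 2) := by
    simp only [← Complex.normSq_eq_norm_sq, Complex.normSq_apply, Complex.sub_re, Complex.sub_im,
      Complex.mul_re, Complex.mul_im, Complex.conj_re, Complex.conj_im, Complex.one_re,
      Complex.one_im]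
    ring
  rw [norm_div, div_le_iff₀ hdp]
  refine le_of_sq_le_sq ?_ (by positivity)
  have hm12 : 0 < 12 / m := by positivity
  have h1 : ‖v‖ ^ 2 - 1 ≤ 3 / 2 * ε := by nlinarith
  have h2 : (‖v‖ ^ 2 - 1) * (1 - ‖a‖ ^ 2) ≤ 3 / 2 * ε * (2 * (1 - ‖a‖)) := by
    have : 0 ≤ 1 - ‖a‖ ^ 2 := by nlinarith
    have h3 : 1 - ‖a‖ ^ 2 ≤ 2 * (1 - ‖a‖) := by nlinarith
    calc _ ≤ 3 / 2 * ε * (1 - ‖a‖ ^ 2) := by gcongr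
      _ ≤ _ := by gcongr
  have h3 : 3 / 2 * ε * (2 * (1 - ‖a‖)) ≤ 12 / m * ‖1 - conj a * v‖ ^ 2 := by
    have : ((1 - ‖a‖) / 2) ^ 2 ≤ ‖1 - conj a * v‖ ^ 2 := by
      apply pow_le_pow_left₀ _ hd; linarith
    calc 3 / 2 * ε * (2 * (1 - ‖a‖)) = 12 / m * (m * ε * (1 - ‖a‖) / 4) := by
          field_simp; ring
      _ ≤ 12 / m * ((1 - ‖a‖) * (1 - ‖a‖) / 4) := by gcongr; linarith
      _ = 12 / m * ((1 - ‖a‖) / 2) ^ 2 := by ring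
      _ ≤ _ := by gcongr
  rw [hid, mul_pow]
  nlinarith [sq_nonneg (12 / m * ‖1 - conj a * v‖)]

lemma norm_blaschkeFactor_le_one {a z : ℂ} (ha : ‖a‖ < 1) (hz : ‖z‖ ≤ 1) :
    ‖(a - z) / (1 - conj a * z)‖ ≤ 1 := by
  rw [norm_div]
  refine div_le_one_of_le₀ (le_of_sq_le_sq ?_ (norm_nonneg _)) (norm_nonneg _)
  have hid : ‖a - z‖ ^ 2 = ‖1 - conj a * z‖ ^ 2 + (‖z‖ ^ 2 - 1) * (1 - ‖a‖ ^ 2) := by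
    simp only [← Complex.normSq_eq_norm_sq, Complex.normSq_apply, Complex.sub_re, Complex.sub_im,
      Complex.mul_re, Complex.mul_im, Complex.conj_re, Complex.conj_im, Complex.one_re,
      Complex.one_im]
    ring
  have h1 : ‖z‖ ^ 2 ≤ 1 := pow_le_one₀ (norm_nonneg _) hz
  have h2 : ‖a‖ ^ 2 ≤ 1 := pow_le_one₀ (norm_nonneg _) ha.le
  nlinarith

lemma prod_norm_blaschkeFactor_le {n : ℕ} {σ : Fin n → ℂ} {v : ℂ} {ε : ℝ} (hn : 1 ≤ n)
    (hσ : ∀ j, n * ε ≤ 1 - ‖σ j‖) (hε : 0 < ε) (hv : ‖v‖ ≤ 1 + ε / 2) (s : Finset (Fin n)) :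
    ∏ i ∈ s, ‖(σ i - v) / (1 - conj (σ i) * v)‖ ≤ Real.exp 12 := by
  have hn' : (1 : ℝ) ≤ n := by exact_mod_cast hn
  have hfac : ∀ i ∈ s, ‖(σ i - v) / (1 - conj (σ i) * v)‖ ≤ Real.exp (12 / n) := fun i _ =>
    (norm_blaschkeFactor_le hn' (hσ i) hε hv).trans
      (by rw [add_comm]; exact Real.add_one_le_exp _)
  calc _ ≤ ∏ i ∈ s, Real.exp (12 / n) := Finset.prod_le_prod (fun _ _ => norm_nonneg _) hfac
    _ = Real.exp (s.card * (12 / n)) := by rw [Finset.prod_const, Real.exp_nat_mul]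
    _ ≤ Real.exp 12 := by
      apply Real.exp_le_exp.mpr
      have : (s.card : ℝ) ≤ n := by exact_mod_cast (Finset.card_le_univ s).trans (by simp)
      calc _ ≤ (n : ℝ) * (12 / n) := by gcongr
        _ = 12 := by field_simp

lemma norm_telescopedKernel_mul_le {n : ℕ} {σ : Fin n → ℂ} {z v : ℂ} {ε : ℝ} (hn : 1 ≤ n)
    (hσ : ∀ j, n * ε ≤ 1 - ‖σ j‖) (hε : 0 < ε) (hz : ‖z‖ ≤ 1) (hv : ‖v‖ ≤ 1 + ε / 2) :
    ‖telescopedKernel σ z v‖ * (ε + ‖1 - conj z * v‖) ≤ 6 * Real.exp 12 := by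
  have hn' : (1 : ℝ) ≤ n := by exact_mod_cast hn
  have hσ1 : ∀ j, ε ≤ 1 - ‖σ j‖ := fun j => le_trans (by nlinarith) (hσ j)
  have hlt : ∀ j, ‖σ j‖ < 1 := fun j => by linarith [hσ1 j]
  have h1exp : 1 ≤ Real.exp 12 := Real.one_le_exp (by norm_num)
  have hz1 : ∀ s : Finset (Fin n), ∏ i ∈ s, ‖(σ i - z) / (1 - conj (σ i) * z)‖ ≤ 1 := fun s =>
    Finset.prod_le_one (fun _ _ => norm_nonneg _)
      fun i _ => norm_blaschkeFactor_le_one (hlt i) hz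
  -- Effective away from the point of the circle nearest z: only the size of the numerator matters.
  have hA : ‖telescopedKernel σ z v‖ * ‖1 - conj z * v‖ ≤ 2 * Real.exp 12 := by
    rw [← norm_mul, telescopedKernel_mul (fun j => one_sub_mul_conj_ne_zero (hlt j) hz)
      (fun j => one_sub_conj_mul_ne_zero (hσ1 j) hε hv)]
    refine (norm_sub_le _ _).trans ?_
    rw [norm_one, norm_mul, RCLike.norm_conj, blaschkeProduct, blaschkeProduct, norm_prod,
      norm_prod]
    have h2 := prod_norm_blaschkeFactor_le hn hσ hε hv Finset.univ
    have h3 := mul_le_mul (hz1 Finset.univ) h2 (Finset.prod_nonneg fun _ _ => norm_nonneg _)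
      zero_le_one
    linarith
  -- Effective near z: each of the n terms is at most a multiple of 1/(nε), so their number cancels.
  have hB : ‖telescopedKernel σ z v‖ * ε ≤ 4 * Real.exp 12 := by
    have hterm : ∀ j, ‖(1 - conj (σ j) * σ j) / ((1 - σ j * conj z) * (1 - conj (σ j) * v)) *
        ∏ i ∈ Finset.univ with i < j,
          (conj ((σ i - z) / (1 - conj (σ i) * z)) * ((σ i - v) / (1 - conj (σ i) * v)))‖ ≤
        4 / (n * ε) * Real.exp 12 := by
      intro j
      rw [norm_mul]
      gcongr
      · have hj := hσ j
        have hnε : 0 < n * ε := by positivity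
        have hd1 : 1 - ‖σ j‖ ≤ ‖1 - σ j * conj z‖ := by
          have h1 : ‖(1 : ℂ)‖ - ‖σ j * conj z‖ ≤ ‖1 - σ j * conj z‖ := norm_sub_norm_le _ _
          rw [norm_one, norm_mul, RCLike.norm_conj] at h1
          nlinarith [norm_nonneg (σ j)]
        have hd2 := half_le_norm_one_sub (hσ1 j) hε hv
        have hnum : ‖1 - conj (σ j) * σ j‖ ≤ 2 * (1 - ‖σ j‖) := by
          have : (1 : ℂ) - conj (σ j) * σ j = ((1 - ‖σ j‖ ^ 2 : ℝ) : ℂ) := by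
            rw [Complex.conj_mul']; push_cast; ring
          rw [this, Complex.norm_real, Real.norm_eq_abs, abs_of_nonneg]
          all_goals nlinarith [norm_nonneg (σ j)]
        have hp : 0 < 1 - ‖σ j‖ := by linarith
        rw [norm_div, norm_mul]
        calc _ ≤ 2 * (1 - ‖σ j‖) / ((1 - ‖σ j‖) * ((1 - ‖σ j‖) / 2)) := by gcongr
          _ = 4 / (1 - ‖σ j‖) := by field_simp; norm_num
          _ ≤ _ := by gcongr
      · rw [norm_prod]
        simp only [norm_mul, RCLike.norm_conj]
        rw [Finset.prod_mul_distrib]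
        have h3 := mul_le_mul (hz1 (Finset.univ.filter (· < j)))
          (prod_norm_blaschkeFactor_le hn hσ hε hv (Finset.univ.filter (· < j)))
          (Finset.prod_nonneg fun _ _ => norm_nonneg _) zero_le_one
        rw [one_mul] at h3
        exact h3
    have hs : ‖telescopedKernel σ z v‖ ≤ n * (4 / (n * ε) * Real.exp 12) := by
      refine (norm_sum_le _ _).trans ((Finset.sum_le_sum fun j _ => hterm j).trans ?_)
      simp
    calc _ ≤ n * (4 / (n * ε) * Real.exp 12) * ε := by gcongr
      _ = _ := by field_simp
  linarith

lemma differentiableAt_telescopedKernel {n : ℕ} {σ : Fin n → ℂ} {z v : ℂ}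
    (hz : ∀ j, 1 - σ j * conj z ≠ 0) (hv : ∀ j, 1 - conj (σ j) * v ≠ 0) :
    DifferentiableAt ℂ (telescopedKernel σ z) v := by
  unfold telescopedKernel
  refine DifferentiableAt.fun_sum fun j _ => DifferentiableAt.mul ?_ ?_
  · exact DifferentiableAt.div (by fun_prop) (by fun_prop) (mul_ne_zero (hz j) (hv j))
  · refine DifferentiableAt.fun_finsetProd fun i _ => DifferentiableAt.const_mul ?_ _
    exact DifferentiableAt.div (by fun_prop) (by fun_prop) (hv i)

/-! ### Pointwise bounds for derivatives by Cauchy's estimate. -/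

/-- The pointwise bound from which all the norm estimates follow. -/
theorem norm_iteratedDeriv_modelKernel_le {n : ℕ} {σ : Fin n → ℂ} {z u : ℂ} {ε : ℝ} (hn : 1 ≤ n)
    (hσ : ∀ j, n * ε ≤ 1 - ‖σ j‖) (hε : 0 < ε) (hz : ‖z‖ ≤ 1) (hu : ‖u‖ < 1) (l : ℕ) :
    ‖iteratedDeriv l (modelKernel σ z) u‖ ≤
      l.factorial * 2 ^ l * (12 * Real.exp 12) /
        ((ε + (1 - ‖u‖)) ^ l * (ε + ‖1 - conj z * u‖)) := by
  have hn' : (1 : ℝ) ≤ n := by exact_mod_cast hn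
  have hσ1 : ∀ j, ε ≤ 1 - ‖σ j‖ := fun j => le_trans (by nlinarith) (hσ j)
  have hlt : ∀ j, ‖σ j‖ < 1 := fun j => by linarith [hσ1 j]
  have hz0 : ∀ j, 1 - σ j * conj z ≠ 0 := fun j => one_sub_mul_conj_ne_zero (hlt j) hz
  have heq : modelKernel σ z =ᶠ[nhds u] telescopedKernel σ z := by
    have hball : Metric.ball (0 : ℂ) 1 ∈ nhds u :=
      Metric.isOpen_ball.mem_nhds (by simpa using hu)
    filter_upwards [hball] with v hv
    have hv1 : ‖v‖ < 1 := by simpa using hv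
    have hne : 1 - conj z * v ≠ 0 := by
      rw [mul_comm]
      exact one_sub_mul_conj_ne_zero hv1 hz
    rw [modelKernel, div_eq_iff hne, telescopedKernel_mul hz0
      fun j => one_sub_conj_mul_ne_zero (hσ1 j) hε (by linarith)]
  rw [heq.iteratedDeriv_eq]
  set R := ε + (1 - ‖u‖) with hR
  have hRp : 0 < R := by linarith
  have hRu : R ≤ ε + ‖1 - conj z * u‖ := by
    have h1 : ‖(1 : ℂ)‖ - ‖conj z * u‖ ≤ ‖1 - conj z * u‖ := norm_sub_norm_le _ _
    rw [norm_one, norm_mul, RCLike.norm_conj] at h1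
    nlinarith [norm_nonneg u]
  have hmem : ∀ v ∈ Metric.closedBall u (R / 2), ‖v‖ ≤ 1 + ε / 2 := by
    intro v hv
    rw [mem_closedBall_iff_norm] at hv
    have : ‖v‖ ≤ ‖v - u‖ + ‖u‖ := by simpa using norm_add_le (v - u) u
    linarith
  have hD : DiffContOnCl ℂ (telescopedKernel σ z) (Metric.ball u (R / 2)) := by
    refine DifferentiableOn.diffContOnCl fun v hv => ?_
    have hv' := hmem v (Metric.closure_ball_subset_closedBall hv)
    exact (differentiableAt_telescopedKernel hz0
      fun j => one_sub_conj_mul_ne_zero (hσ1 j) hε hv').differentiableWithinAt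
  have hb : ∀ v ∈ Metric.sphere u (R / 2),
      ‖telescopedKernel σ z v‖ ≤ 12 * Real.exp 12 / (ε + ‖1 - conj z * u‖) := by
    intro v hv
    have h1 := norm_telescopedKernel_mul_le hn hσ hε hz
      (hmem v (Metric.sphere_subset_closedBall hv))
    rw [mem_sphere_iff_norm] at hv
    -- Moving from u to the sphere costs R / 2, at most half of ε + ‖1 - conj z * u‖; hence the
    -- constant 12 in place of 6.
    have h2 : ‖1 - conj z * u‖ ≤ ‖1 - conj z * v‖ + R / 2 := by
      have e : 1 - conj z * u = (1 - conj z * v) + conj z * (v - u) := by ring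
      rw [e]
      refine (norm_add_le _ _).trans ?_
      rw [norm_mul, RCLike.norm_conj, hv]
      nlinarith
    rw [le_div_iff₀ (by linarith)]
    have h3 := mul_le_mul_of_nonneg_left
      (show (ε + ‖1 - conj z * u‖) / 2 ≤ ε + ‖1 - conj z * v‖ by linarith)
      (norm_nonneg (telescopedKernel σ z v))
    linarith
  refine (Complex.norm_iteratedDeriv_le_of_forall_mem_sphere_norm_le l (by positivity) hD
    hb).trans_eq ?_
  have : ε + ‖1 - conj z * u‖ ≠ 0 := by linarith
  rw [div_pow]
  field_simp

/-! ### Power integrals on the line and circular means. -/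

lemma lintegral_Ioi_rpow {a δ : ℝ} (ha : a < -1) (hδ : 0 < δ) :
    ∫⁻ y in Set.Ioi δ, ENNReal.ofReal (y ^ a) = ENNReal.ofReal (-δ ^ (a + 1) / (a + 1)) := by
  rw [← integral_Ioi_rpow_of_lt ha hδ, ofReal_integral_eq_lintegral_ofReal
    (integrableOn_Ioi_rpow_of_lt ha hδ)]
  filter_upwards [ae_restrict_mem measurableSet_Ioi] with y hy
  exact Real.rpow_nonneg (hδ.trans hy).le _

lemma lintegral_Ioc_zero_rpow {γ ε : ℝ} (hγ : -1 < γ) (hε : 0 < ε) :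
    ∫⁻ s in Set.Ioc 0 ε, ENNReal.ofReal (s ^ γ) = ENNReal.ofReal (ε ^ (γ + 1) / (γ + 1)) := by
  have h1 : ∫ s in Set.Ioc 0 ε, s ^ γ = ε ^ (γ + 1) / (γ + 1) := by
    rw [← intervalIntegral.integral_of_le hε.le, integral_rpow (Or.inl hγ),
      Real.zero_rpow (by linarith), sub_zero]
  rw [← h1, ofReal_integral_eq_lintegral_ofReal]
  · exact (intervalIntegrable_iff_integrableOn_Ioc_of_le hε.le).mp
      (intervalIntegral.intervalIntegrable_rpow' hγ)
  · filter_upwards [ae_restrict_mem measurableSet_Ioc] with y hy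
    exact Real.rpow_nonneg hy.1.le _

lemma lintegral_add_abs_rpow_le {q δ : ℝ} (hq : 1 < q) (hδ : 0 < δ) :
    ∫⁻ x : ℝ, ENNReal.ofReal ((δ + |x|) ^ (-q)) ≤
      ENNReal.ofReal (2 / (q - 1) * δ ^ (1 - q)) := by
  set g : ℝ → ℝ≥0∞ := (Set.Ici δ).indicator fun y => ENNReal.ofReal (y ^ (-q)) with hg
  have hgm : Measurable g :=
    Measurable.indicator (by fun_prop) measurableSet_Ici
  have hgi : ∫⁻ y, g y = ENNReal.ofReal (δ ^ (1 - q) / (q - 1)) := by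
    rw [hg, lintegral_indicator measurableSet_Ici, setLIntegral_congr Ioi_ae_eq_Ici.symm,
      lintegral_Ioi_rpow (by linarith) hδ]
    congr 1
    rw [show -q + 1 = -(q - 1) by ring, neg_div_neg_eq, neg_sub]
  calc ∫⁻ x : ℝ, ENNReal.ofReal ((δ + |x|) ^ (-q))
      -- One copy of `g` serves each half-line, so translation and reflection invariance finish the
      -- computation.
      ≤ ∫⁻ x : ℝ, (g (x + δ) + g (δ - x)) := by
        refine lintegral_mono fun x => ?_
        rcases le_total 0 x with hx | hx
        · refine le_add_right (le_of_eq ?_)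
          rw [hg, Set.indicator_of_mem (by simpa using hx), abs_of_nonneg hx, add_comm]
        · refine le_add_left (le_of_eq ?_)
          rw [hg, Set.indicator_of_mem (by simpa using hx), abs_of_nonpos hx, ← sub_eq_add_neg]
    _ = (∫⁻ y, g y) + ∫⁻ y, g y := by
        rw [lintegral_add_left (by fun_prop), lintegral_add_right_eq_self g δ,
          lintegral_sub_left_eq_self g δ]
    _ = ENNReal.ofReal (2 / (q - 1) * δ ^ (1 - q)) := by
        have : 0 ≤ δ ^ (1 - q) / (q - 1) :=
          div_nonneg (Real.rpow_nonneg hδ.le _) (by linarith)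
        rw [hgi, ← ENNReal.ofReal_add this this]
        congr 1
        ring

lemma half_norm_one_sub_le {a : ℝ} (ha0 : 0 ≤ a) (ha1 : a ≤ 1) {w : ℂ} (hw : ‖w‖ = 1) :
    ‖1 - w‖ / 2 ≤ ‖1 - a * w‖ := by
  have h1 : 1 - a ≤ ‖1 - a * w‖ := by
    have h : ‖(1 : ℂ)‖ - ‖(a : ℂ) * w‖ ≤ ‖1 - a * w‖ := norm_sub_norm_le _ _
    rwa [norm_one, norm_mul, hw, mul_one, Complex.norm_real, Real.norm_of_nonneg ha0] at h
  have h2 : ‖1 - w‖ ≤ ‖1 - a * w‖ + (1 - a) := by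
    have e : 1 - w = (1 - a * w) - ((1 - a : ℝ) : ℂ) * w := by push_cast; ring
    rw [e]
    refine (norm_sub_le _ _).trans ?_
    rw [norm_mul, hw, mul_one, Complex.norm_real, Real.norm_of_nonneg (by linarith)]
  linarith

/-- Jordan's inequality gives |1 - e^(iy)| = 2|sin(y/2)| ≥ 2|y|/π, and passing to the radius a loses
at most a factor 2. -/
lemma abs_div_pi_le_norm_one_sub {a y : ℝ} (ha0 : 0 ≤ a) (ha1 : a ≤ 1) (hy : |y| ≤ Real.pi) :
    |y| / Real.pi ≤ ‖1 - a * Complex.exp (Complex.I * y)‖ := by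
  refine le_trans ?_ (half_norm_one_sub_le ha0 ha1 (Complex.norm_exp_I_mul_ofReal y))
  rw [norm_sub_rev, Complex.norm_exp_I_mul_ofReal_sub_one, Real.norm_eq_abs, abs_mul, abs_two]
  have h := Real.mul_abs_le_abs_sin (x := y / 2) (by rw [abs_div, abs_two]; linarith)
  rw [abs_div, abs_two] at h
  calc _ = 2 / Real.pi * (|y| / 2) := by ring
    _ ≤ _ := h
    _ = _ := by ring

lemma exists_abs_sub_two_pi_le {x : ℝ} (h1 : -(2 * Real.pi) ≤ x) (h2 : x ≤ 3 * Real.pi) :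
    ∃ k ∈ ({-1, 0, 1} : Finset ℤ), |x - k * (2 * Real.pi)| ≤ Real.pi := by
  have := Real.pi_pos
  rcases lt_or_ge x (-Real.pi) with h | h
  · exact ⟨-1, by simp, by push_cast; rw [abs_le]; constructor <;> linarith⟩
  rcases le_or_gt x Real.pi with h' | h'
  · exact ⟨0, by simp, by push_cast; rw [abs_le]; constructor <;> linarith⟩
  · exact ⟨1, by simp, by push_cast; rw [abs_le]; constructor <;> linarith⟩

/-- The circular means of `(ε + |1 - conj z * u|) ^ (-q)`. -/
lemma lintegral_circle_rpow_le {q ε t : ℝ} {z : ℂ} (hq : 1 < q) (hε : 0 < ε) (hz : ‖z‖ ≤ 1)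
    (ht0 : 0 ≤ t) (ht1 : t < 1) {s : Set ℝ} (hsm : MeasurableSet s)
    -- This window contains both (0, 2π], used for Hardy norms, and (-π, π), used for polar
    -- coordinates.
    (hs : s ⊆ Set.Icc (-Real.pi) (2 * Real.pi)) :
    ∫⁻ θ in s, ENNReal.ofReal
        ((ε + ‖1 - conj z * (t * Complex.exp (θ * Complex.I))‖) ^ (-q)) ≤
      ENNReal.ofReal (6 * (2 * Real.pi) ^ q / (q - 1) * (ε + (1 - t)) ^ (1 - q)) := by
  have hpi := Real.pi_pos
  have hpi1 : 1 ≤ Real.pi := by linarith [Real.pi_gt_three]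
  set δ := ε + (1 - t) with hδdef
  have hδ : 0 < δ := by linarith
  set F : ℝ → ℝ≥0∞ := fun y => ENNReal.ofReal ((δ + |y|) ^ (-q)) with hF
  have hFm : Measurable F := by fun_prop
  -- The angle to z is reduced modulo 2π by one of three shifts; summing over all three avoids
  -- splitting `s`.
  have hpt : ∀ θ ∈ s, ENNReal.ofReal
      ((ε + ‖1 - conj z * (t * Complex.exp (θ * Complex.I))‖) ^ (-q)) ≤
      ENNReal.ofReal ((2 * Real.pi) ^ q) *
        ∑ k ∈ ({-1, 0, 1} : Finset ℤ), F (θ - (z.arg + k * (2 * Real.pi))) := by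
    intro θ hθ
    obtain ⟨hθ1, hθ2⟩ := hs hθ
    obtain ⟨k, hk, hkπ⟩ := exists_abs_sub_two_pi_le (x := θ - z.arg)
      (by linarith [z.arg_le_pi]) (by linarith [z.neg_pi_lt_arg])
    rw [sub_sub] at hkπ
    have hrepr : conj z * (t * Complex.exp (θ * Complex.I)) = ((‖z‖ * t : ℝ) : ℂ) *
        Complex.exp (Complex.I * ((θ - (z.arg + k * (2 * Real.pi)) : ℝ) : ℂ)) := by
      conv_lhs => rw [← Complex.norm_mul_exp_arg_mul_I z]
      have e : Complex.exp (Complex.I * ((θ - (z.arg + k * (2 * Real.pi)) : ℝ) : ℂ)) =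
          Complex.exp (-(z.arg * Complex.I)) * Complex.exp (θ * Complex.I) := by
        rw [← Complex.exp_add, Complex.exp_eq_exp_iff_exists_int]
        exact ⟨-k, by push_cast; ring⟩
      rw [e, map_mul, ← Complex.exp_conj, map_mul, Complex.conj_I, Complex.conj_ofReal,
        Complex.conj_ofReal]
      push_cast
      ring_nf
    have ha0 : 0 ≤ ‖z‖ * t := by positivity
    have hat : ‖z‖ * t ≤ t := by nlinarith
    have h1 := abs_div_pi_le_norm_one_sub ha0 (by linarith) hkπ
    rw [← hrepr] at h1
    set y := θ - (z.arg + k * (2 * Real.pi)) with hy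
    have h2 : 1 - t ≤ ‖1 - conj z * (t * Complex.exp (θ * Complex.I))‖ := by
      have h : ‖(1 : ℂ)‖ - ‖conj z * (t * Complex.exp (θ * Complex.I))‖ ≤ _ :=
        norm_sub_norm_le _ _
      rw [norm_one, norm_mul, norm_mul, RCLike.norm_conj, Complex.norm_exp_ofReal_mul_I,
        Complex.norm_real, Real.norm_of_nonneg ht0, mul_one] at h
      linarith
    -- Average of the radial lower bound 1 - t and the angular lower bound |y|/π.
    have h3 : (δ + |y|) / (2 * Real.pi) ≤
        ε + ‖1 - conj z * (t * Complex.exp (θ * Complex.I))‖ := by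
      have h4 : δ / Real.pi ≤ δ := div_le_self hδ.le hpi1
      have h5 : (δ + |y|) / (2 * Real.pi) = (δ / Real.pi + |y| / Real.pi) / 2 := by
        field_simp
      rw [h5]
      linarith
    have hpos : 0 < δ + |y| := by positivity
    calc _ ≤ ENNReal.ofReal (((δ + |y|) / (2 * Real.pi)) ^ (-q)) :=
          ENNReal.ofReal_le_ofReal
            (Real.rpow_le_rpow_of_nonpos (by positivity) h3 (by linarith))
      _ = ENNReal.ofReal ((2 * Real.pi) ^ q) * F y := by
          rw [hF, ← ENNReal.ofReal_mul (by positivity), Real.div_rpow hpos.le (by positivity),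
            Real.rpow_neg (x := 2 * Real.pi) (by positivity), div_inv_eq_mul, mul_comm]
      _ ≤ _ := by
          gcongr
          exact Finset.single_le_sum
            (f := fun k : ℤ => F (θ - (z.arg + k * (2 * Real.pi)))) (fun _ _ => zero_le) hk
  have hFk : ∀ c : ℝ, ∫⁻ θ, F (θ - c) ≤ ENNReal.ofReal (2 / (q - 1) * δ ^ (1 - q)) := fun c => by
    rw [lintegral_sub_right_eq_self F c]
    exact lintegral_add_abs_rpow_le hq hδ
  calc _ ≤ ∫⁻ θ in s, ENNReal.ofReal ((2 * Real.pi) ^ q) *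
        ∑ k ∈ ({-1, 0, 1} : Finset ℤ), F (θ - (z.arg + k * (2 * Real.pi))) :=
        setLIntegral_mono' hsm hpt
    _ ≤ ∫⁻ θ, ENNReal.ofReal ((2 * Real.pi) ^ q) *
        ∑ k ∈ ({-1, 0, 1} : Finset ℤ), F (θ - (z.arg + k * (2 * Real.pi))) :=
        setLIntegral_le_lintegral _ _
    _ = ENNReal.ofReal ((2 * Real.pi) ^ q) *
        ∑ k ∈ ({-1, 0, 1} : Finset ℤ), ∫⁻ θ, F (θ - (z.arg + k * (2 * Real.pi))) := by
        rw [lintegral_const_mul _ (by fun_prop), lintegral_finsetSum _ (by fun_prop)]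
    _ ≤ ENNReal.ofReal ((2 * Real.pi) ^ q) *
        ∑ k ∈ ({-1, 0, 1} : Finset ℤ), ENNReal.ofReal (2 / (q - 1) * δ ^ (1 - q)) := by
        gcongr
        exact hFk _
    _ = _ := by
        have hq1 : 0 < q - 1 := by linarith
        rw [Finset.sum_const, show ({-1, 0, 1} : Finset ℤ).card = 3 from rfl, nsmul_eq_mul,
          show ((3 : ℕ) : ℝ≥0∞) = ENNReal.ofReal 3 by simp, ← ENNReal.ofReal_mul (by norm_num),
          ← ENNReal.ofReal_mul (by positivity)]
        congr 1
        ring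

/-! ### Weighted area integrals. -/

lemma lintegral_Ioi_add_rpow_mul_rpow_le {p γ ε : ℝ} (hγ : -1 < γ) (hp : γ + 1 < p)
    (hε : 0 < ε) :
    ∫⁻ s in Set.Ioi (0 : ℝ), ENNReal.ofReal ((ε + s) ^ (-p) * s ^ γ) ≤
      ENNReal.ofReal ((1 / (γ + 1) + 1 / (p - γ - 1)) * ε ^ (γ + 1 - p)) := by
  -- Below ε the sum ε + s is replaced by ε, above it by s; the hypotheses on γ give convergence at
  -- 0 and at ∞ respectively.
  rw [← Set.Ioc_union_Ioi_eq_Ioi hε.le]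
  refine (lintegral_union_le _ _ _).trans ?_
  have h1 : ∫⁻ s in Set.Ioc 0 ε, ENNReal.ofReal ((ε + s) ^ (-p) * s ^ γ) ≤
      ENNReal.ofReal (1 / (γ + 1) * ε ^ (γ + 1 - p)) := by
    calc _ ≤ ∫⁻ s in Set.Ioc 0 ε, ENNReal.ofReal (ε ^ (-p)) * ENNReal.ofReal (s ^ γ) := by
          refine setLIntegral_mono' measurableSet_Ioc fun s hs => ?_
          rw [← ENNReal.ofReal_mul (by positivity)]
          apply ENNReal.ofReal_le_ofReal
          have := hs.1
          gcongr ?_ * _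
          exact Real.rpow_le_rpow_of_nonpos hε (by linarith) (by linarith)
      _ = _ := by
          rw [lintegral_const_mul _ (by fun_prop), lintegral_Ioc_zero_rpow hγ hε,
            ← ENNReal.ofReal_mul (by positivity), show γ + 1 - p = -p + (γ + 1) by ring,
            Real.rpow_add hε (-p)]
          congr 1
          ring
  have h2 : ∫⁻ s in Set.Ioi ε, ENNReal.ofReal ((ε + s) ^ (-p) * s ^ γ) ≤
      ENNReal.ofReal (1 / (p - γ - 1) * ε ^ (γ + 1 - p)) := by
    calc _ ≤ ∫⁻ s in Set.Ioi ε, ENNReal.ofReal (s ^ (γ - p)) := by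
          refine setLIntegral_mono' measurableSet_Ioi fun s hs => ?_
          have hs0 : 0 < s := hε.trans hs
          apply ENNReal.ofReal_le_ofReal
          rw [show γ - p = -p + γ by ring, Real.rpow_add hs0]
          gcongr ?_ * _
          exact Real.rpow_le_rpow_of_nonpos hs0 (by linarith) (by linarith)
      _ = _ := by
          rw [lintegral_Ioi_rpow (by linarith) hε]
          congr 1
          rw [show γ - p + 1 = γ + 1 - p by ring, show p - γ - 1 = -(γ + 1 - p) by ring]
          rw [one_div, inv_neg, neg_div, div_eq_inv_mul, neg_mul]
  refine (add_le_add h1 h2).trans_eq ?_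
  have hγ1 : 0 < γ + 1 := by linarith
  have hp1 : 0 < p - γ - 1 := by linarith
  rw [← ENNReal.ofReal_add (by positivity) (by positivity), add_mul]

lemma one_sub_sq_rpow_le {t γ : ℝ} (ht0 : 0 ≤ t) (ht1 : t < 1) :
    (1 - t ^ 2) ^ γ ≤ 2 ^ |γ| * (1 - t) ^ γ := by
  rw [show 1 - t ^ 2 = (1 + t) * (1 - t) by ring, Real.mul_rpow (by linarith) (by linarith)]
  have : 0 ≤ (1 - t) ^ γ := Real.rpow_nonneg (by linarith) _
  gcongr
  calc (1 + t) ^ γ ≤ (1 + t) ^ |γ| :=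
        Real.rpow_le_rpow_of_exponent_le (by linarith) (le_abs_self _)
    _ ≤ _ := Real.rpow_le_rpow (by linarith) (by linarith) (abs_nonneg _)

lemma enorm_rpow_le_of_norm_le {w : ℂ} {A R D q : ℝ} {l : ℕ} (hq : 0 ≤ q) (hA : 0 ≤ A)
    (hR : 0 < R) (hD : 0 < D) (h : ‖w‖ ≤ A / (R ^ l * D)) :
    ‖w‖ₑ ^ q ≤ ENNReal.ofReal (A ^ q * R ^ (-(l * q))) * ENNReal.ofReal (D ^ (-q)) := by
  rw [← ofReal_norm, ENNReal.ofReal_rpow_of_nonneg (norm_nonneg _) hq,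
    ← ENNReal.ofReal_mul (by positivity)]
  apply ENNReal.ofReal_le_ofReal
  refine (Real.rpow_le_rpow (norm_nonneg _) h hq).trans_eq ?_
  rw [Real.div_rpow hA (by positivity), Real.mul_rpow (by positivity) hD.le,
    ← Real.rpow_natCast_mul hR.le, Real.rpow_neg hR.le, Real.rpow_neg hD.le, div_eq_mul_inv,
    mul_inv, mul_assoc]

/-- Weighted area integrals of functions with a kernel-type pointwise bound. -/
theorem lintegral_ball_le {q γ ε A : ℝ} {l : ℕ} {z : ℂ} {f : ℂ → ℂ} (hq : 1 < q) (hγ : -1 < γ)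
    (hγl : γ + 2 < (l + 1) * q) (hε : 0 < ε) (hA : 0 ≤ A) (hz : ‖z‖ ≤ 1)
    (hf : ∀ u, ‖u‖ < 1 → ‖f u‖ ≤ A / ((ε + (1 - ‖u‖)) ^ l * (ε + ‖1 - conj z * u‖))) :
    ∫⁻ u in Metric.ball (0 : ℂ) 1, ‖f u‖ₑ ^ q * ENNReal.ofReal ((1 - ‖u‖ ^ 2) ^ γ) ≤
      ENNReal.ofReal (A ^ q * (2 ^ |γ| * (6 * (2 * Real.pi) ^ q / (q - 1)) *
        (1 / (γ + 1) + 1 / ((l + 1) * q - 1 - γ - 1))) * ε ^ (γ + 2 - (l + 1) * q)) := by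
  have hq1 : 0 < q - 1 := by linarith
  have hpi := Real.pi_pos
  set c : ℝ := A ^ q * (2 ^ |γ| * (6 * (2 * Real.pi) ^ q / (q - 1))) with hc
  have hc0 : 0 ≤ c := by positivity
  set g : ℂ → ℝ≥0∞ := (Metric.ball (0 : ℂ) 1).indicator
    fun u => ‖f u‖ₑ ^ q * ENNReal.ofReal ((1 - ‖u‖ ^ 2) ^ γ) with hg
  set h : ℝ → ℝ≥0∞ := (Set.Ioi 0).indicator
    fun s => ENNReal.ofReal ((ε + s) ^ (-((l + 1) * q - 1)) * s ^ γ) with hh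
  have hhm : Measurable h := Measurable.indicator (by fun_prop) measurableSet_Ioi
  -- The exponent (l + 1)q - 1 in `h` collects lq from the radial factor and q - 1 from the circular
  -- mean; the Jacobian t is bounded by 1.
  have hinner : ∀ t ∈ Set.Ioi (0 : ℝ), ∫⁻ θ in Set.Ioo (-Real.pi) Real.pi,
      ENNReal.ofReal t • g (Complex.polarCoord.symm (t, θ)) ≤ ENNReal.ofReal c * h (1 - t) := by
    intro t ht
    have ht0 : 0 < t := ht
    have hnorm : ∀ θ, ‖Complex.polarCoord.symm (t, θ)‖ = t := fun θ => by
      rw [Complex.norm_polarCoord_symm, abs_of_pos ht0]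
    rcases le_or_gt 1 t with h1t | h1t
    · have : ∀ θ, g (Complex.polarCoord.symm (t, θ)) = 0 := fun θ => by
        rw [hg, Set.indicator_of_notMem]
        rwa [mem_ball_zero_iff, hnorm, not_lt]
      simp_rw [this, smul_zero, lintegral_zero, zero_le]
    have hexp : ∀ θ, Complex.polarCoord.symm (t, θ) = t * Complex.exp (θ * Complex.I) :=
      fun θ => by
        rw [Complex.polarCoord_symm_apply, Complex.exp_mul_I]
        push_cast
        rfl
    have hR : 0 < ε + (1 - t) := by linarith
    have hpt : ∀ θ, ENNReal.ofReal t • g (Complex.polarCoord.symm (t, θ)) ≤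
        ENNReal.ofReal (A ^ q * (ε + (1 - t)) ^ (-(l * q)) * (2 ^ |γ| * (1 - t) ^ γ)) *
          ENNReal.ofReal
            ((ε + ‖1 - conj z * (t * Complex.exp (θ * Complex.I))‖) ^ (-q)) := by
      intro θ
      rw [hg, Set.indicator_of_mem (by rwa [mem_ball_zero_iff, hnorm]), smul_eq_mul, hnorm]
      have h1 := hf (Complex.polarCoord.symm (t, θ)) (by rwa [hnorm])
      rw [hnorm] at h1
      have h2 := enorm_rpow_le_of_norm_le (q := q) (by linarith) hA hR (by positivity) h1
      rw [hexp] at h2 ⊢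
      have hx : 0 ≤ (1 - t) ^ γ := Real.rpow_nonneg (by linarith) _
      calc _ ≤ 1 * ((ENNReal.ofReal (A ^ q * (ε + (1 - t)) ^ (-(l * q))) * ENNReal.ofReal
            ((ε + ‖1 - conj z * (t * Complex.exp (θ * Complex.I))‖) ^ (-q))) *
            ENNReal.ofReal (2 ^ |γ| * (1 - t) ^ γ)) := by
            gcongr
            · exact ENNReal.ofReal_le_one.mpr h1t.le
            · exact one_sub_sq_rpow_le ht0.le h1t
        _ = _ := by
            rw [one_mul, mul_right_comm, ← ENNReal.ofReal_mul (by positivity)]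
    calc _ ≤ ∫⁻ θ in Set.Ioo (-Real.pi) Real.pi,
          ENNReal.ofReal (A ^ q * (ε + (1 - t)) ^ (-(l * q)) * (2 ^ |γ| * (1 - t) ^ γ)) *
          ENNReal.ofReal
            ((ε + ‖1 - conj z * (t * Complex.exp (θ * Complex.I))‖) ^ (-q)) :=
          lintegral_mono hpt
      _ = ENNReal.ofReal (A ^ q * (ε + (1 - t)) ^ (-(l * q)) * (2 ^ |γ| * (1 - t) ^ γ)) *
          ∫⁻ θ in Set.Ioo (-Real.pi) Real.pi, ENNReal.ofReal
            ((ε + ‖1 - conj z * (t * Complex.exp (θ * Complex.I))‖) ^ (-q)) :=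
          lintegral_const_mul _ (by fun_prop)
      _ ≤ ENNReal.ofReal (A ^ q * (ε + (1 - t)) ^ (-(l * q)) * (2 ^ |γ| * (1 - t) ^ γ)) *
          ENNReal.ofReal (6 * (2 * Real.pi) ^ q / (q - 1) * (ε + (1 - t)) ^ (1 - q)) := by
          gcongr
          exact lintegral_circle_rpow_le hq hε hz ht0.le h1t measurableSet_Ioo
            fun x hx => ⟨hx.1.le, by linarith [hx.2]⟩
      _ = _ := by
          have hx : 0 ≤ (1 - t) ^ γ := Real.rpow_nonneg (by linarith) _
          rw [hh, Set.indicator_of_mem (by simpa using h1t), ← ENNReal.ofReal_mul (by positivity),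
            ← ENNReal.ofReal_mul hc0, hc,
            show -((l + 1) * q - 1) = -(l * q) + (1 - q) by ring, Real.rpow_add hR]
          congr 1
          ring
  calc _ = ∫⁻ u, g u := by rw [hg, lintegral_indicator Metric.isOpen_ball.measurableSet]
    _ = ∫⁻ p in Set.Ioi (0 : ℝ) ×ˢ Set.Ioo (-Real.pi) Real.pi,
        ENNReal.ofReal p.1 • g (Complex.polarCoord.symm p) := by
        rw [← Complex.lintegral_comp_polarCoord_symm, polarCoord_target]
    _ ≤ ∫⁻ t in Set.Ioi (0 : ℝ), ∫⁻ θ in Set.Ioo (-Real.pi) Real.pi,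
        ENNReal.ofReal t • g (Complex.polarCoord.symm (t, θ)) := by
        rw [Measure.volume_eq_prod, ← Measure.prod_restrict]
        -- This half of Tonelli needs no measurability of `f`.
        exact lintegral_prod_le _
    _ ≤ ∫⁻ t in Set.Ioi (0 : ℝ), ENNReal.ofReal c * h (1 - t) :=
        setLIntegral_mono' measurableSet_Ioi hinner
    _ ≤ ∫⁻ t, ENNReal.ofReal c * h (1 - t) := setLIntegral_le_lintegral _ _
    _ = ENNReal.ofReal c *
        ∫⁻ s in Set.Ioi (0 : ℝ),
          ENNReal.ofReal ((ε + s) ^ (-((l + 1) * q - 1)) * s ^ γ) := by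
        rw [lintegral_const_mul _ (by fun_prop), lintegral_sub_left_eq_self h 1, hh,
          lintegral_indicator measurableSet_Ioi]
    _ ≤ ENNReal.ofReal c * ENNReal.ofReal ((1 / (γ + 1) + 1 / ((l + 1) * q - 1 - γ - 1)) *
          ε ^ (γ + 1 - ((l + 1) * q - 1))) := by
        gcongr
        exact lintegral_Ioi_add_rpow_mul_rpow_le hγ (by linarith) hε
    _ = _ := by
        rw [← ENNReal.ofReal_mul hc0, hc]
        congr 1
        rw [show γ + 1 - ((l + 1) * q - 1) = γ + 2 - (l + 1) * q by ring]
        ring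

/-! ### Norm estimates with ε⁻¹ = n / (1 - r). -/

lemma mul_ofReal_rpow_one_div_le {c : ℝ≥0∞} {K N s q : ℝ} (hc : c ≤ 1) (hK : 0 ≤ K) (hN : 0 < N)
    (hq : 0 < q) :
    (c * ENNReal.ofReal (K * N⁻¹ ^ s)) ^ (1 / q) ≤
      ENNReal.ofReal (K ^ (1 / q) * N ^ (-(s / q))) := by
  calc _ ≤ (1 * ENNReal.ofReal (K * N⁻¹ ^ s)) ^ (1 / q) := by gcongr
    _ = _ := by
      rw [one_mul, ENNReal.ofReal_rpow_of_nonneg (by positivity) (by positivity),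
        Real.mul_rpow hK (by positivity), ← Real.rpow_mul (by positivity),
        Real.inv_rpow hN.le, ← Real.rpow_neg hN.le, mul_one_div]

lemma inv_ofReal_le_one {x : ℝ} (hx : 1 ≤ x) : (ENNReal.ofReal x)⁻¹ ≤ 1 :=
  ENNReal.inv_le_one.mpr (ENNReal.one_le_ofReal.mpr hx)

lemma norm_iteratedDeriv_modelKernel_le_of_norm_le {n : ℕ} {σ : Fin n → ℂ} {r : ℝ} {z u : ℂ}
    (hn : 1 ≤ n) (hσ : ∀ j, ‖σ j‖ ≤ r) (hr : r < 1) (hz : ‖z‖ ≤ 1) (hu : ‖u‖ < 1) (l : ℕ) :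
    ‖iteratedDeriv l (modelKernel σ z) u‖ ≤ l.factorial * 2 ^ l * (12 * Real.exp 12) /
      (((n / (1 - r))⁻¹ + (1 - ‖u‖)) ^ l * ((n / (1 - r))⁻¹ + ‖1 - conj z * u‖)) := by
  have hn' : (0 : ℝ) < n := by exact_mod_cast hn
  have hr' : 0 < 1 - r := by linarith
  refine norm_iteratedDeriv_modelKernel_le hn (fun j => ?_) (by positivity) hz hu l
  have : (n : ℝ) * (n / (1 - r))⁻¹ = 1 - r := by field_simp
  linarith [hσ j]

theorem hardyNorm_top_modelKernel_le {n : ℕ} {σ : Fin n → ℂ} {r : ℝ} {z : ℂ}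
    (hn : 1 ≤ n) (hσ : ∀ j, ‖σ j‖ ≤ r) (hr : r < 1) (hz : ‖z‖ ≤ 1) :
    hardyNorm ∞ (modelKernel σ z) ≤ ENNReal.ofReal (12 * Real.exp 12 * (n / (1 - r))) := by
  have hn' : (0 : ℝ) < n := by exact_mod_cast hn
  have hr' : 0 < 1 - r := by linarith
  rw [hardyNorm, if_pos rfl]
  refine iSup₂_le fun u hu => ?_
  have h := norm_iteratedDeriv_modelKernel_le_of_norm_le hn hσ hr hz
    (mem_ball_zero_iff.mp hu) 0
  rw [iteratedDeriv_zero] at h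
  rw [← ofReal_norm]
  apply ENNReal.ofReal_le_ofReal
  refine h.trans ?_
  simp only [Nat.factorial_zero, Nat.cast_one, pow_zero, one_mul]
  calc _ ≤ 12 * Real.exp 12 / (n / (1 - r))⁻¹ := by
        gcongr
        exact le_add_of_nonneg_right (norm_nonneg _)
    _ = _ := div_inv_eq_mul _ _

theorem hardyNorm_modelKernel_le {q : ℝ≥0∞} (hq : 1 < q) (hqt : q ≠ ∞) {n : ℕ} {σ : Fin n → ℂ}
    {r : ℝ} {z : ℂ} (hn : 1 ≤ n) (hσ : ∀ j, ‖σ j‖ ≤ r) (hr : r < 1) (hz : ‖z‖ ≤ 1) :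
    hardyNorm q (modelKernel σ z) ≤
      ENNReal.ofReal (((12 * Real.exp 12) ^ q.toReal *
        (6 * (2 * Real.pi) ^ q.toReal / (q.toReal - 1))) ^ (1 / q.toReal) *
          (n / (1 - r)) ^ (1 - (q⁻¹).toReal)) := by
  have hn' : (0 : ℝ) < n := by exact_mod_cast hn
  have hr' : 0 < 1 - r := by linarith
  have hp1 : 1 < q.toReal := (ENNReal.lt_ofReal_iff_toReal_lt ENNReal.one_ne_top).mp
    (by rwa [ENNReal.ofReal_toReal hqt])
  rw [hardyNorm, if_neg hqt, ENNReal.toReal_inv]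
  set p := q.toReal
  have hp : 0 < p - 1 := by linarith
  set N : ℝ := n / (1 - r) with hN
  have hNp : 0 < N := by positivity
  refine iSup₂_le fun ρ hρ => ?_
  obtain ⟨hρ0, hρ1⟩ := hρ
  have hpi := Real.pi_gt_three
  have hpt : ∀ θ : ℝ, ‖modelKernel σ z (circleMap 0 ρ θ)‖ₑ ^ p ≤
      ENNReal.ofReal ((12 * Real.exp 12) ^ p) * ENNReal.ofReal
        ((N⁻¹ + ‖1 - conj z * (ρ * Complex.exp (θ * Complex.I))‖) ^ (-p)) := by
    intro θ
    have hnorm : ‖circleMap 0 ρ θ‖ = ρ := by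
      rw [norm_circleMap_zero, abs_of_nonneg hρ0]
    have h := norm_iteratedDeriv_modelKernel_le_of_norm_le hn hσ hr hz
      (u := circleMap 0 ρ θ) (by rwa [hnorm]) 0
    rw [iteratedDeriv_zero, hnorm, ← hN, circleMap_zero] at h
    have h2 := enorm_rpow_le_of_norm_le (q := p) (by linarith) (by positivity)
      (by have := sub_pos.mpr hρ1; positivity) (by positivity) h
    rw [circleMap_zero]
    simpa using h2
  have hint : ∫⁻ θ in Set.Ioc (0 : ℝ) (2 * Real.pi), ‖modelKernel σ z (circleMap 0 ρ θ)‖ₑ ^ p ≤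
      ENNReal.ofReal ((12 * Real.exp 12) ^ p * (6 * (2 * Real.pi) ^ p / (p - 1)) *
        N⁻¹ ^ (1 - p)) := by
    calc _ ≤ ∫⁻ θ in Set.Ioc (0 : ℝ) (2 * Real.pi),
          ENNReal.ofReal ((12 * Real.exp 12) ^ p) * ENNReal.ofReal
          ((N⁻¹ + ‖1 - conj z * (ρ * Complex.exp (θ * Complex.I))‖) ^ (-p)) :=
          lintegral_mono hpt
      _ = ENNReal.ofReal ((12 * Real.exp 12) ^ p) * ∫⁻ θ in Set.Ioc (0 : ℝ) (2 * Real.pi),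
          ENNReal.ofReal
          ((N⁻¹ + ‖1 - conj z * (ρ * Complex.exp (θ * Complex.I))‖) ^ (-p)) :=
          lintegral_const_mul _ (by fun_prop)
      _ ≤ ENNReal.ofReal ((12 * Real.exp 12) ^ p) * ENNReal.ofReal
          (6 * (2 * Real.pi) ^ p / (p - 1) * (N⁻¹ + (1 - ρ)) ^ (1 - p)) := by
          gcongr
          exact lintegral_circle_rpow_le hp1 (by positivity) hz hρ0 hρ1 measurableSet_Ioc
            fun x hx => ⟨by linarith [hx.1], hx.2⟩
      _ ≤ _ := by
          rw [← ENNReal.ofReal_mul (by positivity), ← mul_assoc]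
          apply ENNReal.ofReal_le_ofReal
          gcongr _ * ?_
          exact Real.rpow_le_rpow_of_nonpos (by positivity) (by linarith) (by linarith)
  calc _ ≤ ((ENNReal.ofReal (2 * Real.pi))⁻¹ * ENNReal.ofReal ((12 * Real.exp 12) ^ p *
        (6 * (2 * Real.pi) ^ p / (p - 1)) * N⁻¹ ^ (1 - p))) ^ (1 / p) := by gcongr
    _ ≤ _ := mul_ofReal_rpow_one_div_le (inv_ofReal_le_one (by linarith)) (by positivity) hNp
        (by linarith)
    _ = _ := by
      congr 3
      field_simp
      ring

theorem blochNorm_iteratedDeriv_modelKernel_le {α : ℝ} (l : ℕ) (hα0 : 0 ≤ α) (hα1 : α ≤ 1) {n : ℕ}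
    {σ : Fin n → ℂ} {r : ℝ} {z : ℂ} (hn : 1 ≤ n) (hσ : ∀ j, ‖σ j‖ ≤ r) (hr : r < 1)
    (hz : ‖z‖ ≤ 1) :
    blochNorm α (iteratedDeriv l (modelKernel σ z)) ≤
      ENNReal.ofReal ((l + 1).factorial * 2 ^ (l + 1) * (12 * Real.exp 12) *
        (n / (1 - r)) ^ ((l : ℝ) + 2 - α)) := by
  have hn' : (0 : ℝ) < n := by exact_mod_cast hn
  have hr' : 0 < 1 - r := by linarith
  refine iSup₂_le fun u hu => ?_
  have hu1 : ‖u‖ < 1 := mem_ball_zero_iff.mp hu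
  have h := norm_iteratedDeriv_modelKernel_le_of_norm_le hn hσ hr hz hu1 (l + 1)
  rw [iteratedDeriv_succ] at h
  set N : ℝ := n / (1 - r)
  have hNp : 0 < N := by positivity
  set R := N⁻¹ + (1 - ‖u‖) with hR
  have hNR : N⁻¹ ≤ R := by linarith
  have hNi : 0 < N⁻¹ := by positivity
  have hRp : 0 < R := by linarith
  have hRu : R ≤ N⁻¹ + ‖1 - conj z * u‖ := by
    have h1 : ‖(1 : ℂ)‖ - ‖conj z * u‖ ≤ ‖1 - conj z * u‖ := norm_sub_norm_le _ _
    rw [norm_one, norm_mul, RCLike.norm_conj] at h1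
    nlinarith [norm_nonneg u]
  rw [← ofReal_norm, ← ENNReal.ofReal_mul (norm_nonneg _)]
  apply ENNReal.ofReal_le_ofReal
  have hu0 : 0 ≤ 1 - ‖u‖ := by linarith
  -- The weight is absorbed as R ^ α, and R ≥ N⁻¹ applies because l + 2 - α > 0.
  calc _ ≤ (l + 1).factorial * 2 ^ (l + 1) * (12 * Real.exp 12) / (R ^ (l + 1) * R) * R ^ α := by
        refine mul_le_mul (h.trans ?_) (Real.rpow_le_rpow hu0 (by linarith) hα0) (by positivity)
          (by positivity)
        gcongr
    _ = (l + 1).factorial * 2 ^ (l + 1) * (12 * Real.exp 12) * R ^ (-((l : ℝ) + 2 - α)) := by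
        rw [show -((l : ℝ) + 2 - α) = α - ((l + 2 : ℕ) : ℝ) by push_cast; ring, Real.rpow_sub hRp,
          Real.rpow_natCast, ← pow_succ]
        ring
    _ ≤ (l + 1).factorial * 2 ^ (l + 1) * (12 * Real.exp 12) * N⁻¹ ^ (-((l : ℝ) + 2 - α)) := by
        gcongr _ * ?_
        exact Real.rpow_le_rpow_of_nonpos hNi hNR (by linarith [(l.cast_nonneg : (0 : ℝ) ≤ l)])
    _ = _ := by rw [Real.inv_rpow hNp.le, Real.rpow_neg hNp.le, inv_inv]

theorem exists_bergmanNorm_iteratedDeriv_modelKernel_le {q γ : ℝ} (l : ℕ) (hq : 1 < q)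
    (hγ : -1 < γ) (hγl : γ + 2 < (l + 1) * q) :
    ∃ C : ℝ, 0 < C ∧ ∀ (n : ℕ) (σ : Fin n → ℂ) (r : ℝ) (z : ℂ),
      1 ≤ n → (∀ j, ‖σ j‖ ≤ r) → r < 1 → ‖z‖ ≤ 1 →
      bergmanNorm q γ (iteratedDeriv l (modelKernel σ z)) ≤
        ENNReal.ofReal (C * ((n : ℝ) / (1 - r)) ^ (l + 1 - (γ + 2) / q)) := by
  have hpi := Real.pi_gt_three
  have hq1 : 0 < q - 1 := by linarith
  have hγ1 : 0 < γ + 1 := by linarith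
  have hp1 : 0 < (l + 1) * q - 1 - γ - 1 := by linarith
  set A : ℝ := l.factorial * 2 ^ l * (12 * Real.exp 12)
  set K : ℝ := A ^ q * (2 ^ |γ| * (6 * (2 * Real.pi) ^ q / (q - 1)) *
    (1 / (γ + 1) + 1 / ((l + 1) * q - 1 - γ - 1)))
  have hK : 0 < K := by positivity
  refine ⟨K ^ (1 / q), by positivity, fun n σ r z hn hσ hr hz => ?_⟩
  have hn' : (0 : ℝ) < n := by exact_mod_cast hn
  have hr' : 0 < 1 - r := by linarith
  have hint := lintegral_ball_le (l := l) (f := iteratedDeriv l (modelKernel σ z)) hq hγ hγl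
    (show 0 < ((n : ℝ) / (1 - r))⁻¹ by positivity) (show 0 ≤ A by positivity) hz
    fun u hu => norm_iteratedDeriv_modelKernel_le_of_norm_le hn hσ hr hz hu l
  calc _ ≤ ((ENNReal.ofReal Real.pi)⁻¹ * ENNReal.ofReal
        (K * ((n : ℝ) / (1 - r))⁻¹ ^ (γ + 2 - (l + 1) * q))) ^ (1 / q) := by
        rw [bergmanNorm]
        gcongr
    _ ≤ _ := mul_ofReal_rpow_one_div_le (inv_ofReal_le_one (by linarith)) hK.le (by positivity)
        (by linarith)
    _ = _ := by
      congr 3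
      field_simp
      ring

theorem proposition4p1 :
    (∀ q : ℝ≥0∞, 1 < q →
      ∃ C : ℝ, 0 < C ∧ ∀ (n : ℕ) (σ : Fin n → ℂ) (r : ℝ) (z : ℂ),
        1 ≤ n → (∀ j, ‖σ j‖ ≤ r) → r < 1 → ‖z‖ ≤ 1 →
        hardyNorm q (modelKernel σ z) ≤
          ENNReal.ofReal (C * ((n : ℝ) / (1 - r)) ^ (1 - (q⁻¹).toReal))) ∧
    (∀ (l : ℕ) (α : ℝ), 0 ≤ α → α ≤ 1 →
      ∃ C : ℝ, 0 < C ∧ ∀ (n : ℕ) (σ : Fin n → ℂ) (r : ℝ) (z : ℂ),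
        1 ≤ n → (∀ j, ‖σ j‖ ≤ r) → r < 1 → ‖z‖ ≤ 1 →
        blochNorm α (iteratedDeriv l (modelKernel σ z)) ≤
          ENNReal.ofReal (C * ((n : ℝ) / (1 - r)) ^ ((l : ℝ) + 2 - α))) ∧
    (∀ q γ : ℝ, 1 < q → -1 < γ → γ ≤ q - 1 →
      ∃ C : ℝ, 0 < C ∧ ∀ (n : ℕ) (σ : Fin n → ℂ) (r : ℝ) (z : ℂ),
        1 ≤ n → (∀ j, ‖σ j‖ ≤ r) → r < 1 → ‖z‖ ≤ 1 →
        bergmanNorm q γ (deriv (modelKernel σ z)) ≤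
          ENNReal.ofReal (C * ((n : ℝ) / (1 - r)) ^ (2 - (γ + 2) / q))) ∧
    (∀ q γ : ℝ, 1 < q → -1 < γ → γ ≤ q →
      ∃ C : ℝ, 0 < C ∧ ∀ (n : ℕ) (σ : Fin n → ℂ) (r : ℝ) (z : ℂ),
        1 ≤ n → (∀ j, ‖σ j‖ ≤ r) → r < 1 → ‖z‖ ≤ 1 →
        bergmanNorm q γ (iteratedDeriv 2 (modelKernel σ z)) ≤
          ENNReal.ofReal (C * ((n : ℝ) / (1 - r)) ^ (3 - (γ + 2) / q))) := by
  refine ⟨fun q hq => ?_, fun l α hα0 hα1 => ?_, fun q γ hq hγ hγq => ?_,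
    fun q γ hq hγ hγq => ?_⟩
  · by_cases hqt : q = ∞
    · subst hqt
      refine ⟨12 * Real.exp 12, by positivity, fun n σ r z hn hσ hr hz => ?_⟩
      simpa using hardyNorm_top_modelKernel_le hn hσ hr hz
    · have hp1 : 1 < q.toReal := (ENNReal.lt_ofReal_iff_toReal_lt ENNReal.one_ne_top).mp
        (by rwa [ENNReal.ofReal_toReal hqt])
      have hp : 0 < q.toReal - 1 := by linarith
      exact ⟨_, by positivity, fun n σ r z hn hσ hr hz =>
        hardyNorm_modelKernel_le hq hqt hn hσ hr hz⟩
  · exact ⟨_, by positivity, fun n σ r z hn hσ hr hz =>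
      blochNorm_iteratedDeriv_modelKernel_le l hα0 hα1 hn hσ hr hz⟩
  -- Convergence at infinity: γ + 2 ≤ q + 1 < 2q, as q > 1.
  · obtain ⟨C, hC, h⟩ := exists_bergmanNorm_iteratedDeriv_modelKernel_le 1 hq hγ
      (by push_cast; linarith)
    refine ⟨C, hC, fun n σ r z hn hσ hr hz => ?_⟩
    have h1 := h n σ r z hn hσ hr hz
    rw [iteratedDeriv_one] at h1
    convert h1 using 4
    norm_num
  -- Similarly γ + 2 ≤ q + 2 < 3q.
  · obtain ⟨C, hC, h⟩ := exists_bergmanNorm_iteratedDeriv_modelKernel_le 2 hq hγ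
      (by push_cast; linarith)
    refine ⟨C, hC, fun n σ r z hn hσ hr hz => ?_⟩
    convert h n σ r z hn hσ hr hz using 4
    norm_num
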